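/- Let $M$ be a connected complex manifold of dimension $d$, let $D\subset M$ be a normal crossing divisor (locally $z_1\cdots z_k=0$, $1\le k\le d$, in suitable holomorphic coordinates; its components need not be smooth), and put $M'=M\setminus D$. Let $G=\mathbb{C}^d\rtimes \mathrm{GL}(d,\mathbb{C})$, $H=\mathrm{GL}(d,\mathbb{C})\subset G$ the isotropy group of $0$, $\phi:G\to \mathrm{GL}(d,\mathbb{C})$ the projection, $V=\mathbb{C}^{d}\oplus\mathbb{C}$, and $\chi:G\to\mathrm{GL}(V)$ the representation $\chi(v,A)(u,t)=(Au+tv,\,t)$. Let $(E_H,\theta)$ be a holomorphic affine structure on $M'$, that is, a holomorphic Cartan geometry of type $(G,H)$: a holomorphic principal $H$-bundle $E_H\to M'$ with an $H$-equivariant holomorphic isomorphism $\theta:TE_H\to E_H\times\mathfrak{g}$ that restricts to the Maurer–Cartan form of $H$ on the fibres. The form $\theta$ identifies $TM'$ with the bundle $E_H\times^H\mathbb{C}^d=E_G\times^\phi\mathbb{C}^d$, where $E_G=E_H\times^H G$, and $E^V_H:=E_H\times^H V$ with $TM'\oplus\mathcal{O}_{M'}$; it induces a holomorphic connection $\nabla^V$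 on $E^V_H$ through $\chi$ and a holomorphic connection $\nabla^T$ on $TM'$ through $\phi$ (on sections regarded as $H$-equivariant functions $f$ on $E_H$, these are $df+d\chi(\theta)f$ and $df+d\phi(\theta)f$). Let $\widetilde{TM'}$ be any holomorphic vector bundle on $M$ that extends $TM'$, i.e. comes with a holomorphic isomorphism $\widetilde{TM'}|_{M'}\cong TM'$, and let $\widetilde{E}^V_H=\widetilde{TM'}\oplus\mathcal{O}_M$ be the resulting extension of $E^V_H=TM'\oplus\mathcal{O}_{M'}$. A holomorphic connection $\nabla$ on the restriction to $M'$ of a holomorphic vector bundle $F$ on $M$ is called a logarithmic connection on $F$ if, for every open $U\subset M$, every section $v$ of $TM(-\log D)$ over $U$ and every holomorphic section $s$ of $F$ over $U$, the section $\nabla_v s$ over $U\setminus D$ extends to a holomorphic section of $F$ over $U$. Here $TM(-\log D)\subset TM$ is the sheaf of holomorphic vector fields that map holomorphic functions vanishing on $D$ to functions vanishing on $D$. If $\nabla^V$ is a logarithmic connection on $\widetilde{E}^V_H$, then $\nabla^T$ is a logarithmic connection on $\widetilde{TM'}$. -/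

import Mathlib

open scoped Manifold ContDiff Bundle RightActions
open Set Bundle

set_option linter.unusedSectionVars false

noncomputable section
namespace LogAffine

/-! ### General linear group, affine group and the representations used -/

/-- The model space `ℂ^d`. -/
abbrev Cd (d : ℕ) : Type := EuclideanSpace ℂ (Fin d)
/-- The complex Lie group `GL(d, ℂ)`, the units of the algebra of endomorphisms of `ℂ^d`. -/
abbrev GLd (d : ℕ) : Type := (Cd d →L[ℂ] Cd d)ˣ

instance (d : ℕ) : ChartedSpace (Cd d →L[ℂ] Cd d) (GLd d) :=
  inferInstance

/-- The affine group `ℂ^d ⋊ GL(d, ℂ)`; the pair `(v, A)` is the map `x ↦ A x + v`. -/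
def AffGroup (d : ℕ) : Type := Cd d × GLd d

namespace AffGroup
variable {d : ℕ}

instance : TopologicalSpace (AffGroup d) := inferInstanceAs (TopologicalSpace (Cd d × GLd d))
instance : ChartedSpace (ModelProd (Cd d) (Cd d →L[ℂ] Cd d)) (AffGroup d) :=
  inferInstanceAs (ChartedSpace (ModelProd (Cd d) (Cd d →L[ℂ] Cd d)) (Cd d × GLd d))

/-- The affine group is a complex manifold modelled on `ℂ^d × End(ℂ^d)`. -/
abbrev I (d : ℕ) : ModelWithCorners ℂ (Cd d × (Cd d →L[ℂ] Cd d))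
    (ModelProd (Cd d) (Cd d →L[ℂ] Cd d)) :=
  𝓘(ℂ, Cd d).prod 𝓘(ℂ, Cd d →L[ℂ] Cd d)

instance : IsManifold (I d) ω (AffGroup d) :=
  inferInstanceAs (IsManifold (I d) ω (Cd d × GLd d))

def mk (v : Cd d) (A : GLd d) : AffGroup d := (v, A)
def trans (g : AffGroup d) : Cd d := g.1
def lin (g : AffGroup d) : GLd d := g.2

@[ext] theorem ext {g h : AffGroup d} (h₁ : g.trans = h.trans) (h₂ : g.lin = h.lin) : g = h :=
  Prod.ext h₁ h₂

instance : Mul (AffGroup d) := ⟨fun g h => mk (g.trans + (g.lin : Cd d →L[ℂ] Cd d) h.trans) (g.lin * h.lin)⟩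
instance : One (AffGroup d) := ⟨mk 0 1⟩
instance : Inv (AffGroup d) :=
  ⟨fun g => mk (-((g.lin⁻¹ : GLd d) : Cd d →L[ℂ] Cd d) g.trans) g.lin⁻¹⟩

@[simp] theorem trans_mk (v : Cd d) (A : GLd d) : (mk v A).trans = v := rfl
@[simp] theorem lin_mk (v : Cd d) (A : GLd d) : (mk v A).lin = A := rfl
@[simp] theorem trans_mul (g h : AffGroup d) :
    (g * h).trans = g.trans + (g.lin : Cd d →L[ℂ] Cd d) h.trans := rfl
@[simp] theorem lin_mul (g h : AffGroup d) : (g * h).lin = g.lin * h.lin := rfl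
@[simp] theorem trans_one : (1 : AffGroup d).trans = 0 := rfl
@[simp] theorem lin_one : (1 : AffGroup d).lin = 1 := rfl
@[simp] theorem trans_inv (g : AffGroup d) :
    (g⁻¹).trans = -((g.lin⁻¹ : GLd d) : Cd d →L[ℂ] Cd d) g.trans := rfl
@[simp] theorem lin_inv (g : AffGroup d) : (g⁻¹).lin = g.lin⁻¹ := rfl

instance : Group (AffGroup d) :=
  Group.ofLeftAxioms
    (fun a b c => by ext1 <;> simp [mul_assoc, add_assoc])
    (fun a => by ext1 <;> simp)
    (fun a => by ext1 <;> simp)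

theorem contMDiff_mk {N : Type*} {E' H' : Type*} [NormedAddCommGroup E'] [NormedSpace ℂ E']
    [TopologicalSpace H'] {J : ModelWithCorners ℂ E' H'} [TopologicalSpace N] [ChartedSpace H' N]
    {v : N → Cd d} {A : N → GLd d}
    (hv : ContMDiff J 𝓘(ℂ, Cd d) ω v) (hA : ContMDiff J 𝓘(ℂ, Cd d →L[ℂ] Cd d) ω A) :
    ContMDiff J (I d) ω (fun n => mk (v n) (A n)) :=
  hv.prodMk hA

theorem contMDiff_trans : ContMDiff (I d) 𝓘(ℂ, Cd d) ω (trans : AffGroup d → Cd d) :=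
  contMDiff_fst (M := Cd d) (N := GLd d)

theorem contMDiff_lin : ContMDiff (I d) 𝓘(ℂ, Cd d →L[ℂ] Cd d) ω (lin : AffGroup d → GLd d) :=
  contMDiff_snd (M := Cd d) (N := GLd d)

theorem contMDiff_lin_val : ContMDiff (I d) 𝓘(ℂ, Cd d →L[ℂ] Cd d) ω
    (fun g : AffGroup d => (g.lin : Cd d →L[ℂ] Cd d)) :=
  Units.contMDiff_val.comp contMDiff_lin

/-- The affine group is a complex Lie group. -/
instance : LieGroup (I d) ω (AffGroup d) where
  contMDiff_mul := contMDiff_mk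
    ((contMDiff_trans.comp contMDiff_fst).add
      ((contMDiff_lin_val.comp contMDiff_fst).clm_apply (contMDiff_trans.comp contMDiff_snd)))
    ((contMDiff_lin.comp contMDiff_fst).mul (contMDiff_lin.comp contMDiff_snd))
  contMDiff_inv := contMDiff_mk
    ((Units.contMDiff_val.comp contMDiff_lin.inv).clm_apply contMDiff_trans).neg
    contMDiff_lin.inv

/-- The inclusion `GL(d, ℂ) ⊂ ℂ^d ⋊ GL(d, ℂ)` as the isotropy group of `0`. -/
def ofLin (d : ℕ) : GLd d →* AffGroup d where
  toFun A := mk 0 A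
  map_one' := rfl
  map_mul' A B := by ext1 <;> simp

/-- The natural projection `φ : ℂ^d ⋊ GL(d, ℂ) → GL(d, ℂ)`. -/
def linHom (d : ℕ) : AffGroup d →* GLd d where
  toFun := lin
  map_one' := rfl
  map_mul' _ _ := rfl

/-- The linear map `(u, t) ↦ (A u + t v, t)` of `ℂ^d ⊕ ℂ` attached to `(v, A)`. -/
def stdMap (g : AffGroup d) : Cd d × ℂ →L[ℂ] Cd d × ℂ :=
  (((g.lin : Cd d →L[ℂ] Cd d).comp (ContinuousLinearMap.fst ℂ (Cd d) ℂ)) +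
    (ContinuousLinearMap.snd ℂ (Cd d) ℂ).smulRight g.trans).prod (ContinuousLinearMap.snd ℂ (Cd d) ℂ)

@[simp] theorem stdMap_apply (g : AffGroup d) (x : Cd d × ℂ) :
    stdMap g x = ((g.lin : Cd d →L[ℂ] Cd d) x.1 + x.2 • g.trans, x.2) := rfl

/-- The representation `χ` of `ℂ^d ⋊ GL(d, ℂ)` on `V = ℂ^d ⊕ ℂ = ℂ^(d+1)`. -/
def stdHom (d : ℕ) : AffGroup d →* (Cd d × ℂ →L[ℂ] Cd d × ℂ)ˣ :=
  MonoidHom.toHomUnits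
    { toFun := stdMap
      map_one' := by ext x <;> simp
      map_mul' := fun g h => by
        ext x <;> simp [add_comm] }

end AffGroup

section Cartan

variable {E : Type*} [NormedAddCommGroup E] [NormedSpace ℂ E]
  {M : Type*} [TopologicalSpace M] [ChartedSpace E M]
  {EP : Type*} [NormedAddCommGroup EP] [NormedSpace ℂ EP]
  {P : Type*} [TopologicalSpace P] [ChartedSpace EP P]
  {EH HH : Type*} [NormedAddCommGroup EH] [NormedSpace ℂ EH] [TopologicalSpace HH]
  {IH : ModelWithCorners ℂ EH HH}
  {H : Type*} [TopologicalSpace H] [ChartedSpace HH H] [Group H]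
  {EG HG : Type*} [NormedAddCommGroup EG] [NormedSpace ℂ EG] [TopologicalSpace HG]
  {IG : ModelWithCorners ℂ EG HG}
  {G : Type*} [TopologicalSpace G] [ChartedSpace HG G] [Group G]
  {W : Type*} [NormedAddCommGroup W] [NormedSpace ℂ W]

/-- `pr : P → M` makes the complex manifold `P`, with its right `H`-action `p <• h`, a holomorphic
principal `H`-bundle over the open subset `Ω` of the complex manifold `M`. A local trivialization
over `U` is given as the equivariant biholomorphic map `U × H → pr⁻¹ U`, `(y, h) ↦ s y <• h`, with
inverse `p ↦ (pr p, τ p)`. -/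
structure IsHolPrincipalBundle (IH : ModelWithCorners ℂ EH HH) (H : Type*) [TopologicalSpace H]
    [ChartedSpace HH H] [Group H] [MulAction Hᵐᵒᵖ P] (pr : P → M) (Ω : Set M) : Prop where
  mem : ∀ p, pr p ∈ Ω
  contMDiff_proj : ContMDiff 𝓘(ℂ, EP) 𝓘(ℂ, E) ω pr
  contMDiff_act : ContMDiff (𝓘(ℂ, EP).prod IH) 𝓘(ℂ, EP) ω (fun z : P × H => z.1 <• z.2)
  proj_act : ∀ (p : P) (h : H), pr (p <• h) = pr p
  exists_trivialization : ∀ x ∈ Ω, ∃ U : Set M, IsOpen U ∧ x ∈ U ∧ U ⊆ Ω ∧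
    ∃ (s : M → P) (τ : P → H),
      ContMDiffOn 𝓘(ℂ, E) 𝓘(ℂ, EP) ω s U ∧ ContMDiffOn 𝓘(ℂ, EP) IH ω τ (pr ⁻¹' U) ∧
      (∀ y ∈ U, pr (s y) = y) ∧ (∀ y ∈ U, ∀ h : H, τ (s y <• h) = h) ∧
      ∀ p ∈ pr ⁻¹' U, s (pr p) <• τ p = p

/-- The adjoint action of `G` on its Lie algebra `𝔤 = T_1 G`: the derivative of conjugation. -/
def Ad (IG : ModelWithCorners ℂ EG HG) (g : G) :
    GroupLieAlgebra IG G →L[ℂ] GroupLieAlgebra IG G :=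
  mfderiv IG IG (fun x : G => g * x * g⁻¹) 1

/-- The Lie algebra map of a homomorphism of Lie groups. -/
def lieMap (IH : ModelWithCorners ℂ EH HH) (IG : ModelWithCorners ℂ EG HG) (j : H →* G) :
    GroupLieAlgebra IH H →L[ℂ] GroupLieAlgebra IG G :=
  mfderiv IH IG j 1

/-- The infinitesimal representation `dρ : 𝔤 → End(W)` of `ρ : G → GL(W)`. -/
def infRep (IG : ModelWithCorners ℂ EG HG) (ρ : G →* (W →L[ℂ] W)ˣ) :
    GroupLieAlgebra IG G →L[ℂ] (W →L[ℂ] W) :=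
  mvfderiv IG (fun g => (ρ g : W →L[ℂ] W)) 1

/-- The vertical tangent vector at `p` generated by `A ∈ 𝔥`: the derivative of `h ↦ p h` at `1`. -/
def fundVec (IH : ModelWithCorners ℂ EH HH) [MulAction Hᵐᵒᵖ P] (p : P) :
    GroupLieAlgebra IH H →L[ℂ] TangentSpace 𝓘(ℂ, EP) p :=
  mfderiv IH 𝓘(ℂ, EP) (fun h : H => p <• h) 1

/-- The derivative at `p` of the right translation by `h`. -/
def rightMap [MulAction Hᵐᵒᵖ P] (p : P) (h : H) :
    TangentSpace 𝓘(ℂ, EP) p →L[ℂ] TangentSpace 𝓘(ℂ, EP) (p <• h) :=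
  mfderiv 𝓘(ℂ, EP) 𝓘(ℂ, EP) (fun q : P => q <• h) p

variable [IsManifold 𝓘(ℂ, EP) ω P]

/-- A holomorphic Cartan geometry of type `(G, H)` on the open subset `Ω` of `M`: a holomorphic
principal `H`-bundle `pr : P → Ω` with a holomorphic isomorphism `θ : TP → P × 𝔤` that is
`H`-equivariant and restricts to the Maurer-Cartan form of `H` on the fibres. The inclusion of `H`
in `G` is `j`. -/
structure CartanGeometry (IH : ModelWithCorners ℂ EH HH) (IG : ModelWithCorners ℂ EG HG)
    (j : H →* G) [MulAction Hᵐᵒᵖ P] (pr : P → M) (Ω : Set M) where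
  isPrincipal : IsHolPrincipalBundle (E := E) (EP := EP) IH H pr Ω
  θ : ∀ p : P, TangentSpace 𝓘(ℂ, EP) p ≃L[ℂ] GroupLieAlgebra IG G
  contMDiff_θ : ContMDiff (M' := EG) 𝓘(ℂ, EP).tangent 𝓘(ℂ, EG) ω
    (fun X : TangentBundle 𝓘(ℂ, EP) P => θ X.proj X.snd)
  θ_rightMap : ∀ (p : P) (h : H) (X : TangentSpace 𝓘(ℂ, EP) p),
    θ (p <• h) (rightMap p h X) = Ad IG (j h⁻¹) (θ p X)
  θ_fundVec : ∀ (p : P) (A : GroupLieAlgebra IH H), θ p (fundVec IH p A) = lieMap IH IG j A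

/-- The `W`-valued functions `f` on `P` with `f (p h) = ρ(h)⁻¹ f p`, that is, the sections of the
associated bundle `P ×^H W` (the value of the section at `pr p` is the class of `(p, f p)`). -/
def IsEquivariant (j : H →* G) (ρ : G →* (W →L[ℂ] W)ˣ) [MulAction Hᵐᵒᵖ P] (f : P → W) : Prop :=
  ∀ (p : P) (h : H), f (p <• h) = ((ρ (j h))⁻¹ : (W →L[ℂ] W)ˣ).1 (f p)

section principal
variable [MulAction Hᵐᵒᵖ P] {pr : P → M} {Ω : Set M}

theorem IsHolPrincipalBundle.mdiff_orbit
    (b : IsHolPrincipalBundle (E := E) (EP := EP) IH H pr Ω) (p : P) (h : H) :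
    MDifferentiableAt IH 𝓘(ℂ, EP) (fun h : H => p <• h) h :=
  ((b.contMDiff_act.comp (contMDiff_const.prodMk contMDiff_id)).mdifferentiable
    (by simp)) h

theorem IsHolPrincipalBundle.mdiff_right
    (b : IsHolPrincipalBundle (E := E) (EP := EP) IH H pr Ω) (p : P) (h : H) :
    MDifferentiableAt 𝓘(ℂ, EP) 𝓘(ℂ, EP) (fun q : P => q <• h) p :=
  ((b.contMDiff_act.comp (contMDiff_id.prodMk contMDiff_const)).mdifferentiable
    (by simp)) p

theorem IsHolPrincipalBundle.mdiff_proj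
    (b : IsHolPrincipalBundle (E := E) (EP := EP) IH H pr Ω) (p : P) :
    MDifferentiableAt 𝓘(ℂ, EP) 𝓘(ℂ, E) pr p :=
  b.contMDiff_proj.mdifferentiable (by simp) p

theorem IsHolPrincipalBundle.mfderiv_surjective
    (b : IsHolPrincipalBundle (E := E) (EP := EP) IH H pr Ω) (p : P) :
    Function.Surjective (mfderiv 𝓘(ℂ, EP) 𝓘(ℂ, E) pr p) := by
  obtain ⟨U, hU, hxU, -, s, τ, hs, -, hps, -, hsp⟩ := b.exists_trivialization _ (b.mem p)
  have hp : s (pr p) <• τ p = p := hsp p hxU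
  have hsd : MDifferentiableAt 𝓘(ℂ, E) 𝓘(ℂ, EP) s (pr p) :=
    (hs.contMDiffAt (hU.mem_nhds hxU)).mdifferentiableAt (by simp)
  have h1 : MDifferentiableAt 𝓘(ℂ, E) 𝓘(ℂ, EP) (fun y => s y <• τ p) (pr p) :=
    (b.mdiff_right (s (pr p)) (τ p)).comp (pr p) hsd
  have h2 : MDifferentiableAt 𝓘(ℂ, EP) 𝓘(ℂ, E) pr (s (pr p) <• τ p) := b.mdiff_proj _
  have h3 : (fun y => pr (s y <• τ p)) =ᶠ[nhds (pr p)] id := by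
    filter_upwards [hU.mem_nhds hxU] with y hy
    simp [b.proj_act, hps y hy]
  have h4 := h3.mfderiv_eq (I := 𝓘(ℂ, E)) (I' := 𝓘(ℂ, E))
  have h5 := mfderiv_comp (pr p) h2 h1
  intro w
  have h6 : ∀ w : E, (mfderiv 𝓘(ℂ, E) 𝓘(ℂ, E) (fun y => pr (s y <• τ p)) (pr p) : E → E) w = w := by
    intro w
    rw [h4, mfderiv_id]; rfl
  have h7 := h6 w
  rw [show (fun y => pr (s y <• τ p)) = pr ∘ (fun y => s y <• τ p) from rfl, h5] at h7
  have key : ∀ q, q = p → (∃ Y : EP, (mfderiv 𝓘(ℂ, EP) 𝓘(ℂ, E) pr q : EP → E) Y = w) →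
      (∃ Y : EP, (mfderiv 𝓘(ℂ, EP) 𝓘(ℂ, E) pr p : EP → E) Y = w) := by
    rintro q rfl h; exact h
  exact key _ hp ⟨_, h7⟩

theorem IsHolPrincipalBundle.mfderiv_fundVec
    (b : IsHolPrincipalBundle (E := E) (EP := EP) IH H pr Ω) (p : P) (A : GroupLieAlgebra IH H) :
    mfderiv 𝓘(ℂ, EP) 𝓘(ℂ, E) pr p (fundVec IH p A) = 0 := by
  have h := mfderiv_comp_apply_of_eq (x := (1 : H)) (b.mdiff_proj p) (b.mdiff_orbit p 1) (by simp) A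
  refine Eq.trans h.symm ?_
  have : (pr ∘ fun h : H => p <• h) = fun _ => pr p := by
    funext h; exact b.proj_act p h
  rw [this, mfderiv_const]; rfl

theorem IsHolPrincipalBundle.exists_fundVec [LieGroup IH ω H]
    (b : IsHolPrincipalBundle (E := E) (EP := EP) IH H pr Ω) (p : P) (X : TangentSpace 𝓘(ℂ, EP) p)
    (hX : mfderiv 𝓘(ℂ, EP) 𝓘(ℂ, E) pr p X = 0) :
    ∃ A : GroupLieAlgebra IH H, fundVec IH p A = X := by
  obtain ⟨U, hU, hxU, -, s, τ, hs, hτ, hps, -, hsp⟩ := b.exists_trivialization _ (b.mem p)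
  have hp : s (pr p) <• τ p = p := hsp p hxU
  have hUP : IsOpen (pr ⁻¹' U) := hU.preimage b.contMDiff_proj.continuous
  have hsd : MDifferentiableAt 𝓘(ℂ, E) 𝓘(ℂ, EP) s (pr p) :=
    (hs.contMDiffAt (hU.mem_nhds hxU)).mdifferentiableAt (by simp)
  have hτd : MDifferentiableAt 𝓘(ℂ, EP) IH τ p :=
    (hτ.contMDiffAt (hUP.mem_nhds hxU)).mdifferentiableAt (by simp)
  set Φ : M × H → P := fun z => s z.1 <• z.2 with hΦ
  have hΦd : MDifferentiableAt (𝓘(ℂ, E).prod IH) 𝓘(ℂ, EP) Φ (pr p, τ p) := by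
    have h1 : MDifferentiableAt (𝓘(ℂ, EP).prod IH) 𝓘(ℂ, EP) (fun z : P × H => z.1 <• z.2)
      (s (pr p), τ p) := b.contMDiff_act.mdifferentiable (by simp) _
    exact h1.comp (pr p, τ p) (f := fun z : M × H => (s z.1, z.2))
      ((hsd.comp (pr p, τ p) mdifferentiableAt_fst).prodMk mdifferentiableAt_snd)
  have hid : (Φ ∘ fun q => (pr q, τ q)) =ᶠ[nhds p] id := by
    filter_upwards [hUP.mem_nhds hxU] with q hq
    exact hsp q hq
  have e1 := hid.mfderiv_eq (I := 𝓘(ℂ, EP)) (I' := 𝓘(ℂ, EP))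
  have e2 := mfderiv_comp_apply (f := fun q => (pr q, τ q)) p hΦd ((b.mdiff_proj p).prodMk hτd) X
  rw [e1, mfderiv_prodMk (b.mdiff_proj p) hτd, mfderiv_prod_eq_add_apply hΦd, mfderiv_id] at e2
  have e3 : (X : EP) = (mfderiv 𝓘(ℂ, E) 𝓘(ℂ, EP) (fun z => Φ (z, τ p)) (pr p) : E → EP)
        (mfderiv 𝓘(ℂ, EP) 𝓘(ℂ, E) pr p X) +
      (mfderiv IH 𝓘(ℂ, EP) (fun z => Φ (pr p, z)) (τ p) : EH → EP)
        (mfderiv 𝓘(ℂ, EP) IH τ p X) := e2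
  have e4 : (mfderiv 𝓘(ℂ, E) 𝓘(ℂ, EP) (fun z => Φ (z, τ p)) (pr p) : E → EP)
        (mfderiv 𝓘(ℂ, EP) 𝓘(ℂ, E) pr p X) = 0 := by
    rw [hX]; exact map_zero (mfderiv 𝓘(ℂ, E) 𝓘(ℂ, EP) (fun z => Φ (z, τ p)) (pr p))
  have hc : (fun z => Φ (pr p, z)) = (fun h : H => p <• h) ∘ (fun h => (τ p)⁻¹ * h) := by
    funext z
    have : (p <• ((τ p)⁻¹ * z) : P) = (s (pr p) <• τ p) <• ((τ p)⁻¹ * z) := by rw [hp]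
    simp only [hΦ, Function.comp, this]
    simp [smul_smul, ← MulOpposite.op_mul, -MulOpposite.op_inv]
  have hl : MDifferentiableAt IH IH (fun h : H => (τ p)⁻¹ * h) (τ p) :=
    ((contMDiff_mul_left (I := IH) (n := ω) (a := (τ p)⁻¹)).mdifferentiable (by simp)) _
  have e5 := mfderiv_comp_apply_of_eq (x := τ p) (b.mdiff_orbit p 1) hl (by simp)
    (mfderiv 𝓘(ℂ, EP) IH τ p X)
  rw [e4, zero_add, hc] at e3
  exact ⟨_, (e3.trans e5).symm⟩

end principal

namespace CartanGeometry
variable {j : H →* G} [MulAction Hᵐᵒᵖ P] {pr : P → M} {Ω : Set M}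

/-- The connection induced by `θ` on the bundle `P ×^H W` of a representation `ρ : G → GL(W)`: the
connection form on the `GL(W)`-bundle obtained from `P` restricts to `dρ ∘ θ` on `P`, so that the
covariant derivative of the section given by the equivariant function `f` is the `W`-valued
1-form `df + dρ(θ) f` on `P`. It is horizontal and equivariant (see the lemmas below), so it
is again a section of `P ×^H W` with values in the cotangent bundle. -/
def covDeriv (c : CartanGeometry (E := E) (EP := EP) IH IG j pr Ω) (ρ : G →* (W →L[ℂ] W)ˣ)
    (f : P → W) (p : P) : TangentSpace 𝓘(ℂ, EP) p →L[ℂ] W :=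
  mvfderiv 𝓘(ℂ, EP) f p +
    ((ContinuousLinearMap.apply ℂ W (f p)).comp (infRep IG ρ)).comp
      (c.θ p : TangentSpace 𝓘(ℂ, EP) p →L[ℂ] GroupLieAlgebra IG G)

theorem infRep_eq {ρ : G →* (W →L[ℂ] W)ˣ} (a : GroupLieAlgebra IG G) :
    infRep IG ρ a = mfderiv IG 𝓘(ℂ, W →L[ℂ] W) (fun g => (ρ g : W →L[ℂ] W)) 1 a := rfl

theorem mvfderiv_clm_apply {a : H → W →L[ℂ] W} {v : H → W} {x : H}
    (ha : MDifferentiableAt IH 𝓘(ℂ, W →L[ℂ] W) a x) (hv : MDifferentiableAt IH 𝓘(ℂ, W) v x)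
    (A : TangentSpace IH x) :
    mvfderiv IH (fun h => a h (v h)) x A = mvfderiv IH a x A (v x) + a x (mvfderiv IH v x A) := by
  have h := ha.hasMFDerivAt.2.clm_apply hv.hasMFDerivAt.2
  have h' : HasMFDerivAt IH 𝓘(ℂ, W) (fun h => a h (v h)) x _ :=
    ⟨ha.continuousAt.clm_apply hv.continuousAt, h⟩
  have h2 : (mfderiv IH 𝓘(ℂ, W) (fun h => a h (v h)) x : EH →L[ℂ] W) A = _ :=
    DFunLike.congr_fun h'.mfderiv A
  refine Eq.trans h2 ?_
  rw [add_comm]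
  simp [writtenInExtChartAt]
  rfl

/-- The covariant derivative is horizontal. -/
theorem covDeriv_fundVec (c : CartanGeometry (E := E) (EP := EP) IH IG j pr Ω) {ρ : G →* (W →L[ℂ] W)ˣ}
    (hρ : ContMDiff IG 𝓘(ℂ, W →L[ℂ] W) ω (fun g => (ρ g : W →L[ℂ] W)))
    (hj : ContMDiff IH IG ω j)
    {f : P → W} (hf : IsEquivariant j ρ f) {p : P}
    (hd : MDifferentiableAt 𝓘(ℂ, EP) 𝓘(ℂ, W) f p) (A : GroupLieAlgebra IH H) :
    c.covDeriv ρ f p (fundVec IH p A) = 0 := by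
  have hρd : MDifferentiableAt IG 𝓘(ℂ, W →L[ℂ] W) (fun g => (ρ g : W →L[ℂ] W)) 1 :=
    hρ.mdifferentiable (by simp) _
  have hjd : MDifferentiableAt IH IG j 1 := hj.mdifferentiable (by simp) _
  -- the curve `h ↦ ρ (j h) (f (p h))` is constant
  have hconst : (fun h : H => (ρ (j h) : W →L[ℂ] W) (f (p <• h))) = fun _ => f p := by
    funext h
    rw [hf p h, ← mul_apply_eq_comp, ← Units.val_mul]
    simp
  have h1 := mfderiv_comp_apply_of_eq (x := (1 : H)) hρd hjd (map_one j) A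
  have h2 := mfderiv_comp_apply_of_eq (x := (1 : H)) hd (c.isPrincipal.mdiff_orbit p 1) (by simp) A
  have hd1 : MDifferentiableAt IH 𝓘(ℂ, W →L[ℂ] W) ((fun g => (ρ g : W →L[ℂ] W)) ∘ j) (1 : H) :=
    (hρ.comp hj).mdifferentiable (by simp) _
  have hd2 : MDifferentiableAt IH 𝓘(ℂ, W) (f ∘ fun h : H => p <• h) 1 :=
    MDifferentiableAt.comp (1 : H) (by simpa using hd) (c.isPrincipal.mdiff_orbit p 1)
  have h3 := mvfderiv_clm_apply hd1 hd2 A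
  have h4 : mvfderiv IH (fun h : H => (ρ (j h) : W →L[ℂ] W) (f (p <• h))) 1 A = 0 := by
    rw [hconst, mvfderiv_const]; rfl
  have h5 := h3.symm.trans h4
  have h6 : infRep IG ρ (c.θ p (fundVec IH p A)) (f p) + mvfderiv 𝓘(ℂ, EP) f p (fundVec IH p A) = 0 := by
    rw [c.θ_fundVec]
    have e : ((ρ (j 1) : (W →L[ℂ] W)ˣ) : W →L[ℂ] W) = 1 := by simp
    simp only [Function.comp, e, MulOpposite.op_one, one_smul] at h5
    rw [← h5]
    exact congrArg₂ (· + ·) (congrArg (fun T : W →L[ℂ] W => T (f p)) h1.symm) h2.symm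
  rw [add_comm] at h6
  exact h6

theorem infRep_Ad [LieGroup IG ω G] {ρ : G →* (W →L[ℂ] W)ˣ}
    (hρ : ContMDiff IG 𝓘(ℂ, W →L[ℂ] W) ω (fun g => (ρ g : W →L[ℂ] W))) (g : G)
    (a : GroupLieAlgebra IG G) :
    infRep IG ρ (Ad IG g a) =
      (ρ g : W →L[ℂ] W) * infRep IG ρ a * ((ρ g)⁻¹ : (W →L[ℂ] W)ˣ) := by
  have hρd : MDifferentiableAt IG 𝓘(ℂ, W →L[ℂ] W) (fun g => (ρ g : W →L[ℂ] W)) 1 :=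
    hρ.mdifferentiable (by simp) _
  have hc : MDifferentiableAt IG IG (fun x : G => g * x * g⁻¹) 1 :=
    ((contMDiff_const.mul contMDiff_id).mul contMDiff_const : ContMDiff IG IG ω _).mdifferentiable
      (by simp) _
  have h1 := mfderiv_comp_apply_of_eq (x := (1 : G)) hρd hc (by simp) a
  set L : (W →L[ℂ] W) →L[ℂ] (W →L[ℂ] W) :=
    ((ContinuousLinearMap.compL ℂ W W W).flip (((ρ g)⁻¹ : (W →L[ℂ] W)ˣ) : W →L[ℂ] W)).comp
      (ContinuousLinearMap.compL ℂ W W W (ρ g : W →L[ℂ] W)) with hL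
  have h2 := mfderiv_comp_apply_of_eq (x := (1 : G)) (g := L) (I' := 𝓘(ℂ, W →L[ℂ] W))
    (I'' := 𝓘(ℂ, W →L[ℂ] W))
    (L.mdifferentiableAt) hρd rfl a
  have e : (fun g => (ρ g : W →L[ℂ] W)) ∘ (fun x : G => g * x * g⁻¹) =
      L ∘ (fun g => (ρ g : W →L[ℂ] W)) := by
    funext x
    simp only [hL, Function.comp, map_mul, map_inv]
    rfl
  rw [e] at h1
  have h3 := h1.symm.trans h2
  rw [ContinuousLinearMap.mfderiv_eq] at h3
  exact h3

/-- The covariant derivative is equivariant. -/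
theorem covDeriv_rightMap [LieGroup IG ω G] (c : CartanGeometry (E := E) (EP := EP) IH IG j pr Ω)
    {ρ : G →* (W →L[ℂ] W)ˣ}
    (hρ : ContMDiff IG 𝓘(ℂ, W →L[ℂ] W) ω (fun g => (ρ g : W →L[ℂ] W)))
    {f : P → W} (hf : IsEquivariant j ρ f) {p : P}
    (hd : MDifferentiableAt 𝓘(ℂ, EP) 𝓘(ℂ, W) f p) (h : H) (X : TangentSpace 𝓘(ℂ, EP) p) :
    c.covDeriv ρ f (p <• h) (rightMap p h X) =
      ((ρ (j h))⁻¹ : (W →L[ℂ] W)ˣ).1 (c.covDeriv ρ f p X) := by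
  set L : W →L[ℂ] W := ((ρ (j h))⁻¹ : (W →L[ℂ] W)ˣ).1 with hL
  have hd' : MDifferentiableAt 𝓘(ℂ, EP) 𝓘(ℂ, W) f (p <• h) := by
    have e : f = L ∘ f ∘ fun q : P => q <• h⁻¹ := by
      funext q
      have := hf (q <• h⁻¹) h
      simpa using this
    rw [e]
    refine L.mdifferentiableAt.comp _ (MDifferentiableAt.comp _ ?_
      (c.isPrincipal.mdiff_right (p <• h) h⁻¹))
    simpa using hd
  have e : f ∘ (fun q : P => q <• h) = L ∘ f := by
    funext q; exact hf q h
  have h1 := mfderiv_comp_apply (x := p) hd' (c.isPrincipal.mdiff_right p h) X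
  have h2 := mfderiv_comp_apply_of_eq (x := p) (g := L) (I' := 𝓘(ℂ, W))
    (I'' := 𝓘(ℂ, W)) L.mdifferentiableAt hd rfl X
  rw [e] at h1
  have h3 := h1.symm.trans h2
  rw [ContinuousLinearMap.mfderiv_eq] at h3
  have h4 : mvfderiv 𝓘(ℂ, EP) f (p <• h) (rightMap p h X) = L (mvfderiv 𝓘(ℂ, EP) f p X) := h3
  have h5 : infRep IG ρ (c.θ (p <• h) (rightMap p h X)) (f (p <• h)) =
      L (infRep IG ρ (c.θ p X) (f p)) := by
    rw [c.θ_rightMap, infRep_Ad hρ, hf p h]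
    have e : ((ρ (j h⁻¹))⁻¹ : (W →L[ℂ] W)ˣ).1 (((ρ (j h))⁻¹ : (W →L[ℂ] W)ˣ).1 (f p)) = f p := by
      rw [← mul_apply_eq_comp, ← Units.val_mul]; simp
    rw [mul_apply_eq_comp, mul_apply_eq_comp, e]
    simp [hL]
  have h6 : c.covDeriv ρ f (p <• h) (rightMap p h X) =
    mvfderiv 𝓘(ℂ, EP) f (p <• h) (rightMap p h X) +
      infRep IG ρ (c.θ (p <• h) (rightMap p h X)) (f (p <• h)) := rfl
  have h7 : c.covDeriv ρ f p X =
    mvfderiv 𝓘(ℂ, EP) f p X + infRep IG ρ (c.θ p X) (f p) := rfl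
  rw [h6, h7, h4, h5, map_add]

end CartanGeometry
end Cartan
section Affine

variable {d : ℕ} {M : Type*} [TopologicalSpace M] [ChartedSpace (Cd d) M]
  {EP : Type*} [NormedAddCommGroup EP] [NormedSpace ℂ EP]
  {P : Type*} [TopologicalSpace P] [ChartedSpace EP P] [IsManifold 𝓘(ℂ, EP) ω P]
  [MulAction (GLd d)ᵐᵒᵖ P] {pr : P → M} {Ω : Set M}

variable (d EP) in
/-- A holomorphic affine structure on `Ω`: a holomorphic Cartan geometry of type
`(ℂ^d ⋊ GL(d, ℂ), GL(d, ℂ))`. -/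
abbrev AffineStructure (pr : P → M) (Ω : Set M) :=
  CartanGeometry (E := Cd d) (EP := EP) 𝓘(ℂ, Cd d →L[ℂ] Cd d) (AffGroup.I d) (AffGroup.ofLin d) pr Ω

/-- The embedding of `ℂ^d` in the Lie algebra of `ℂ^d ⋊ GL(d, ℂ)` as the translations. -/
def transDir (d : ℕ) : Cd d →L[ℂ] GroupLieAlgebra (AffGroup.I d) (AffGroup d) :=
  mfderiv 𝓘(ℂ, Cd d) (AffGroup.I d) (fun v : Cd d => AffGroup.mk v 1) 0

namespace AffGroup

theorem contMDiff_ofLin : ContMDiff 𝓘(ℂ, Cd d →L[ℂ] Cd d) (I d) ω (ofLin d) :=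
  contMDiff_mk contMDiff_const contMDiff_id

theorem contMDiff_linHom :
    ContMDiff (I d) 𝓘(ℂ, Cd d →L[ℂ] Cd d) ω (fun g => (linHom d g : Cd d →L[ℂ] Cd d)) :=
  contMDiff_lin_val

theorem contMDiff_stdHom :
    ContMDiff (I d) 𝓘(ℂ, Cd d × ℂ →L[ℂ] Cd d × ℂ) ω
      (fun g => (stdHom d g : Cd d × ℂ →L[ℂ] Cd d × ℂ)) := by
  have h : (fun g => (stdHom d g : Cd d × ℂ →L[ℂ] Cd d × ℂ)) = fun g : AffGroup d =>
      ((ContinuousLinearMap.inl ℂ (Cd d) ℂ).comp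
        ((g.lin : Cd d →L[ℂ] Cd d).comp (ContinuousLinearMap.fst ℂ (Cd d) ℂ))) +
      ((ContinuousLinearMap.smulRightL ℂ (Cd d × ℂ) (Cd d × ℂ)
        (ContinuousLinearMap.snd ℂ (Cd d) ℂ)).comp (ContinuousLinearMap.inl ℂ (Cd d) ℂ) g.trans +
      (ContinuousLinearMap.inr ℂ (Cd d) ℂ).comp (ContinuousLinearMap.snd ℂ (Cd d) ℂ)) := by
    funext g
    ext x <;> simp [stdHom]
  rw [h]
  refine ContMDiff.add ?_ (ContMDiff.add ?_ contMDiff_const)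
  · exact contMDiff_const.clm_comp (contMDiff_lin_val.clm_comp contMDiff_const)
  · exact (ContinuousLinearMap.contMDiff _).comp contMDiff_trans

theorem exists_eq_transDir_add (a : GroupLieAlgebra (I d) (AffGroup d)) :
    ∃ (u : Cd d) (A : GroupLieAlgebra 𝓘(ℂ, Cd d →L[ℂ] Cd d) (GLd d)),
      a = transDir d u + lieMap 𝓘(ℂ, Cd d →L[ℂ] Cd d) (I d) (ofLin d) A := by
  have h1 : ∀ u : Cd d, transDir d u = (u, (0 : Cd d →L[ℂ] Cd d)) := by
    intro u
    have := mfderiv_prod_left (I := 𝓘(ℂ, Cd d)) (I' := 𝓘(ℂ, Cd d →L[ℂ] Cd d)) (x₀ := (0 : Cd d)) (y₀ := (1 : GLd d))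
    exact DFunLike.congr_fun this u
  have h2 : ∀ A : Cd d →L[ℂ] Cd d, lieMap 𝓘(ℂ, Cd d →L[ℂ] Cd d) (I d) (ofLin d) A = ((0 : Cd d), A) := by
    intro A
    have := mfderiv_prod_right (I := 𝓘(ℂ, Cd d)) (I' := 𝓘(ℂ, Cd d →L[ℂ] Cd d)) (x₀ := (0 : Cd d)) (y₀ := (1 : GLd d))
    exact DFunLike.congr_fun this A
  let b : Cd d × (Cd d →L[ℂ] Cd d) := a
  refine ⟨b.1, b.2, ?_⟩
  rw [h1, h2]
  change b = (b.1, (0 : Cd d →L[ℂ] Cd d)) + ((0 : Cd d), b.2)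
  simp

theorem Ad_transDir (A : GLd d) (u : Cd d) :
    Ad (I d) (ofLin d A) (transDir d u) = transDir d ((A : Cd d →L[ℂ] Cd d) u) := by
  have ht : MDifferentiable 𝓘(ℂ, Cd d) (I d) (fun v : Cd d => AffGroup.mk v 1) :=
    (contMDiff_mk contMDiff_id contMDiff_const).mdifferentiable (by simp)
  have hc : MDifferentiableAt (I d) (I d) (fun x : AffGroup d => ofLin d A * x * (ofLin d A)⁻¹) 1 :=
    ((contMDiff_const.mul contMDiff_id).mul contMDiff_const :
      ContMDiff (I d) (I d) ω _).mdifferentiable (by simp) _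
  have h1 := mfderiv_comp_apply_of_eq (x := (0 : Cd d)) hc (ht 0) rfl u
  have h2 := mfderiv_comp_apply_of_eq (x := (0 : Cd d)) (g := fun v : Cd d => AffGroup.mk v 1)
    (f := (A : Cd d →L[ℂ] Cd d)) (I' := 𝓘(ℂ, Cd d)) (ht 0)
    (A : Cd d →L[ℂ] Cd d).mdifferentiableAt (map_zero _) u
  have e : (fun x : AffGroup d => ofLin d A * x * (ofLin d A)⁻¹) ∘ (fun v : Cd d => AffGroup.mk v 1)
      = (fun v : Cd d => AffGroup.mk v 1) ∘ (A : Cd d →L[ℂ] Cd d) := by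
    funext v
    ext1 <;> simp [ofLin]
  rw [e] at h1
  rw [ContinuousLinearMap.mfderiv_eq] at h2
  exact h1.symm.trans h2

end AffGroup

namespace AffineStructure

/-- The linear map `ℂ^d → T_{pr p} M`, `u ↦ d pr (θ_p⁻¹ u)`. -/
def frameMap (c : AffineStructure d EP pr Ω) (p : P) :
    Cd d →L[ℂ] TangentSpace 𝓘(ℂ, Cd d) (pr p) :=
  (mfderiv 𝓘(ℂ, EP) 𝓘(ℂ, Cd d) pr p).comp
    (((c.θ p).symm : GroupLieAlgebra (AffGroup.I d) (AffGroup d) →L[ℂ] TangentSpace 𝓘(ℂ, EP) p).comp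
      (transDir d))

theorem frameMap_surjective (c : AffineStructure d EP pr Ω) (p : P) :
    Function.Surjective (c.frameMap p) := by
  intro w
  obtain ⟨X, rfl⟩ := c.isPrincipal.mfderiv_surjective p w
  obtain ⟨u, A, h⟩ := AffGroup.exists_eq_transDir_add (c.θ p X)
  refine ⟨u, ?_⟩
  rw [← c.θ_fundVec p] at h
  have h' : X = (c.θ p).symm (transDir d u) + fundVec 𝓘(ℂ, Cd d →L[ℂ] Cd d) p A := by
    apply (c.θ p).injective
    rw [h, map_add, ContinuousLinearEquiv.apply_symm_apply]
  rw [h', map_add, c.isPrincipal.mfderiv_fundVec, add_zero]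
  rfl

theorem frameMap_injective (c : AffineStructure d EP pr Ω) (p : P) :
    Function.Injective (c.frameMap p) := by
  let L : Cd d →ₗ[ℂ] Cd d := (c.frameMap p).toLinearMap
  exact (LinearMap.injective_iff_surjective (f := L)).2 (c.frameMap_surjective p)

/-- The point `p` of `P` as a frame of `M` at `pr p`. This is the identification of the associated
bundle `P ×^H ℂ^d = P ×^H (𝔤/𝔥)` with the tangent bundle of `Ω`: the class of `(p, u)` is the
tangent vector `frame p u`. -/
def frame (c : AffineStructure d EP pr Ω) (p : P) :
    Cd d ≃L[ℂ] TangentSpace 𝓘(ℂ, Cd d) (pr p) :=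
  let e : Cd d ≃ₗ[ℂ] Cd d := LinearEquiv.ofBijective (c.frameMap p).toLinearMap
    ⟨c.frameMap_injective p, c.frameMap_surjective p⟩
  e.toContinuousLinearEquiv

theorem frame_apply (c : AffineStructure d EP pr Ω) (p : P) (u : Cd d) :
    c.frame p u = c.frameMap p u := rfl

/-- The identification of `E^V_H = P ×^H V`, `V = ℂ^d ⊕ ℂ`, with `TΩ ⊕ 𝓞`: the class of
`(p, (u, t))` is `(frame p u, t)`. -/
def frameV (c : AffineStructure d EP pr Ω) (p : P) :
    (Cd d × ℂ) ≃L[ℂ] (TangentSpace 𝓘(ℂ, Cd d) (pr p) × ℂ) :=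
  (c.frame p).prodCongr (ContinuousLinearEquiv.refl ℂ ℂ)


theorem exists_pt (c : AffineStructure d EP pr Ω) {x : M} (hx : x ∈ Ω) : ∃ p, pr p = x := by
  obtain ⟨U, -, hxU, -, s, τ, -, -, hps, -, -⟩ := c.isPrincipal.exists_trivialization x hx
  exact ⟨s x, hps x hxU⟩

theorem exists_act_eq (c : AffineStructure d EP pr Ω) {p q : P} (h : pr q = pr p) :
    ∃ A : GLd d, q = p <• A := by
  obtain ⟨U, -, hxU, -, s, τ, -, -, -, -, hsp⟩ :=
    c.isPrincipal.exists_trivialization _ (c.isPrincipal.mem p)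
  have hp := hsp p hxU
  have hq := hsp q (by simpa [h] using hxU)
  refine ⟨(τ p)⁻¹ * τ q, ?_⟩
  have : (p <• ((τ p)⁻¹ * τ q) : P) = (s (pr p) <• τ p) <• ((τ p)⁻¹ * τ q) := by rw [hp]
  calc q = s (pr q) <• τ q := hq.symm
    _ = s (pr p) <• τ q := by rw [h]
    _ = p <• ((τ p)⁻¹ * τ q) := by
      rw [this]
      simp [smul_smul, ← MulOpposite.op_mul, -MulOpposite.op_inv]

/-- The lift to `T_p P` of a tangent vector of `M` along the translations. -/
def lift (c : AffineStructure d EP pr Ω) (p : P) :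
    TangentSpace 𝓘(ℂ, Cd d) (pr p) →L[ℂ] TangentSpace 𝓘(ℂ, EP) p :=
  ((c.θ p).symm : GroupLieAlgebra (AffGroup.I d) (AffGroup d) →L[ℂ] TangentSpace 𝓘(ℂ, EP) p).comp
    ((transDir d).comp
      ((c.frame p).symm : TangentSpace 𝓘(ℂ, Cd d) (pr p) →L[ℂ] Cd d))

theorem mfderiv_lift (c : AffineStructure d EP pr Ω) (p : P)
    (w : TangentSpace 𝓘(ℂ, Cd d) (pr p)) :
    mfderiv 𝓘(ℂ, EP) 𝓘(ℂ, Cd d) pr p (c.lift p w) = w := by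
  have h : c.frame p ((c.frame p).symm w) = w := (c.frame p).apply_symm_apply w
  exact h

theorem frame_act (c : AffineStructure d EP pr Ω) (p : P) (A : GLd d) (u : Cd d) :
    (c.frame (p <• A) u : Cd d) = c.frame p ((A : Cd d →L[ℂ] Cd d) u) := by
  set X := (c.θ p).symm (transDir d ((A : Cd d →L[ℂ] Cd d) u)) with hX
  have h1 : c.θ (p <• A) (rightMap p A X) = transDir d u := by
    rw [c.θ_rightMap, hX, ContinuousLinearEquiv.apply_symm_apply, AffGroup.Ad_transDir,
      ← mul_apply_eq_comp, ← Units.val_mul]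
    simp
  have h2 : (c.θ (p <• A)).symm (transDir d u) = rightMap p A X := by
    rw [← h1, ContinuousLinearEquiv.symm_apply_apply]
  have h3 := mfderiv_comp_apply (x := p) (c.isPrincipal.mdiff_proj (p <• A))
    (c.isPrincipal.mdiff_right p A) X
  have e : pr ∘ (fun q : P => q <• A) = pr := by
    funext q; exact c.isPrincipal.proj_act q A
  rw [e] at h3
  have h4 : c.frame (p <• A) u =
    mfderiv 𝓘(ℂ, EP) 𝓘(ℂ, Cd d) pr (p <• A) ((c.θ (p <• A)).symm (transDir d u)) := rfl
  rw [h4, h2]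
  exact h3.symm

/-- The equivariant function `P → ℂ^d` that corresponds to a section of the tangent bundle. -/
def fieldFun (c : AffineStructure d EP pr Ω) (σ : ∀ x : M, TangentSpace 𝓘(ℂ, Cd d) x) : P → Cd d :=
  fun q => (c.frame q).symm (σ (pr q))

/-- The equivariant function `P → V` that corresponds to a section of `TΩ ⊕ 𝓞 = E^V_H`. -/
def fieldFunV (c : AffineStructure d EP pr Ω) (σ : ∀ x : M, TangentSpace 𝓘(ℂ, Cd d) x × ℂ) :
    P → Cd d × ℂ :=
  fun q => (c.frameV q).symm (σ (pr q))

theorem frame_symm_act (c : AffineStructure d EP pr Ω) (p : P) (A : GLd d) (w : Cd d) :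
    (c.frame (p <• A)).symm w = ((A⁻¹ : GLd d) : Cd d →L[ℂ] Cd d) ((c.frame p).symm w) := by
  apply (c.frame (p <• A)).injective
  refine ((c.frame (p <• A)).apply_symm_apply w).trans ?_
  have h := c.frame_act p A (((A⁻¹ : GLd d) : Cd d →L[ℂ] Cd d) ((c.frame p).symm w))
  rw [← mul_apply_eq_comp, ← Units.val_mul, mul_inv_cancel] at h
  have h2 : c.frame p ((c.frame p).symm w) = w := (c.frame p).apply_symm_apply w
  exact (h.trans h2).symm

theorem isEquivariant_fieldFun (c : AffineStructure d EP pr Ω)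
    (σ : ∀ x : M, TangentSpace 𝓘(ℂ, Cd d) x) :
    IsEquivariant (AffGroup.ofLin d) (AffGroup.linHom d) (c.fieldFun σ) := by
  intro p A
  have h := c.frame_symm_act p A (σ (pr p))
  have e : ∀ x, x = pr p → (c.frame (p <• A)).symm (σ x : Cd d) = (c.frame (p <• A)).symm (σ (pr p) : Cd d) := by
    rintro x rfl; rfl
  exact (e _ (c.isPrincipal.proj_act p A)).trans h

theorem isEquivariant_fieldFunV (c : AffineStructure d EP pr Ω)
    (σ : ∀ x : M, TangentSpace 𝓘(ℂ, Cd d) x × ℂ) :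
    IsEquivariant (AffGroup.ofLin d) (AffGroup.stdHom d) (c.fieldFunV σ) := by
  intro p A
  have h := c.isEquivariant_fieldFun (fun x => (σ x).1) p A
  rw [← map_inv, ← map_inv]
  have h2 : (σ (pr (p <• A))).2 = (σ (pr p)).2 := by rw [c.isPrincipal.proj_act]
  refine Prod.ext ?_ ?_
  · refine h.trans ?_
    rw [← map_inv, ← map_inv]
    simp [AffGroup.stdHom, AffGroup.linHom, AffGroup.ofLin, fieldFunV, fieldFun, frameV]
    rfl
  · exact h2

/-- The covariant derivative of a section of the tangent bundle, computed at the point `p` of `P`. -/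
def nablaAt (c : AffineStructure d EP pr Ω) (σ : ∀ x : M, TangentSpace 𝓘(ℂ, Cd d) x) (p : P) :
    TangentSpace 𝓘(ℂ, Cd d) (pr p) →L[ℂ] TangentSpace 𝓘(ℂ, Cd d) (pr p) :=
  (c.frame p : Cd d →L[ℂ] TangentSpace 𝓘(ℂ, Cd d) (pr p)).comp
    ((c.covDeriv (AffGroup.linHom d) (c.fieldFun σ) p).comp (c.lift p))

/-- The covariant derivative of a section of `TΩ ⊕ 𝓞 = E^V_H`, computed at the point `p` of `P`. -/
def nablaVAt (c : AffineStructure d EP pr Ω) (σ : ∀ x : M, TangentSpace 𝓘(ℂ, Cd d) x × ℂ) (p : P) :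
    TangentSpace 𝓘(ℂ, Cd d) (pr p) →L[ℂ] TangentSpace 𝓘(ℂ, Cd d) (pr p) × ℂ :=
  (c.frameV p : Cd d × ℂ →L[ℂ] TangentSpace 𝓘(ℂ, Cd d) (pr p) × ℂ).comp
    ((c.covDeriv (AffGroup.stdHom d) (c.fieldFunV σ) p).comp (c.lift p))

/-- A point of `P` over `x`. -/
def pt (c : AffineStructure d EP pr Ω) {x : M} (hx : x ∈ Ω) : P := (c.exists_pt hx).choose

theorem pr_pt (c : AffineStructure d EP pr Ω) {x : M} (hx : x ∈ Ω) : pr (c.pt hx) = x :=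
  (c.exists_pt hx).choose_spec

open Classical in
/-- The connection `∇^T` on the tangent bundle of `Ω`, induced through `φ : G → GL(d, ℂ)`. The value is
`0` outside `Ω`; it does not depend on the chosen points and lifts, see `nablaT_mfderiv`. -/
def nablaT (c : AffineStructure d EP pr Ω) (σ : ∀ x : M, TangentSpace 𝓘(ℂ, Cd d) x) (x : M) :
    TangentSpace 𝓘(ℂ, Cd d) x →L[ℂ] TangentSpace 𝓘(ℂ, Cd d) x :=
  if hx : x ∈ Ω then c.pr_pt hx ▸ c.nablaAt σ (c.pt hx) else 0

open Classical in
/-- The connection `∇^V` on `TΩ ⊕ 𝓞 = E^V_H`, induced through `χ : G → GL(V)`. The value is `0` outside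
`Ω`; it does not depend on the chosen points and lifts, see `nablaV_mfderiv`. -/
def nablaV (c : AffineStructure d EP pr Ω) (σ : ∀ x : M, TangentSpace 𝓘(ℂ, Cd d) x × ℂ) (x : M) :
    TangentSpace 𝓘(ℂ, Cd d) x →L[ℂ] TangentSpace 𝓘(ℂ, Cd d) x × ℂ :=
  if hx : x ∈ Ω then c.pr_pt hx ▸ c.nablaVAt σ (c.pt hx) else 0

theorem nablaT_apply_eq (c : AffineStructure d EP pr Ω) (σ : ∀ x : M, TangentSpace 𝓘(ℂ, Cd d) x)
    {x : M} (hx : x ∈ Ω) (w : Cd d) :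
    (c.nablaT σ x w : Cd d) = c.nablaAt σ (c.pt hx) w := by
  have key : ∀ (p : P) (h : pr p = x),
      ((h ▸ c.nablaAt σ p : TangentSpace 𝓘(ℂ, Cd d) x →L[ℂ] TangentSpace 𝓘(ℂ, Cd d) x) w : Cd d) =
        c.nablaAt σ p w := by
    rintro p rfl; rfl
  rw [nablaT, dif_pos hx]
  exact key _ _

theorem nablaV_apply_eq (c : AffineStructure d EP pr Ω)
    (σ : ∀ x : M, TangentSpace 𝓘(ℂ, Cd d) x × ℂ) {x : M} (hx : x ∈ Ω) (w : Cd d) :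
    (c.nablaV σ x w : Cd d × ℂ) = c.nablaVAt σ (c.pt hx) w := by
  have key : ∀ (p : P) (h : pr p = x),
      ((h ▸ c.nablaVAt σ p : TangentSpace 𝓘(ℂ, Cd d) x →L[ℂ] TangentSpace 𝓘(ℂ, Cd d) x × ℂ) w :
        Cd d × ℂ) = c.nablaVAt σ p w := by
    rintro p rfl; rfl
  rw [nablaV, dif_pos hx]
  exact key _ _

theorem covDeriv_eq_of_mfderiv_eq (c : AffineStructure d EP pr Ω)
    {W : Type*} [NormedAddCommGroup W] [NormedSpace ℂ W] {ρ : AffGroup d →* (W →L[ℂ] W)ˣ}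
    (hρ : ContMDiff (AffGroup.I d) 𝓘(ℂ, W →L[ℂ] W) ω (fun g => (ρ g : W →L[ℂ] W)))
    {f : P → W} (hf : IsEquivariant (AffGroup.ofLin d) ρ f) {p : P}
    (hd : MDifferentiableAt 𝓘(ℂ, EP) 𝓘(ℂ, W) f p) {X Y : TangentSpace 𝓘(ℂ, EP) p}
    (h : mfderiv 𝓘(ℂ, EP) 𝓘(ℂ, Cd d) pr p X = mfderiv 𝓘(ℂ, EP) 𝓘(ℂ, Cd d) pr p Y) :
    c.covDeriv ρ f p X = c.covDeriv ρ f p Y := by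
  obtain ⟨A, hA⟩ := c.isPrincipal.exists_fundVec p (X - Y) (by rw [map_sub, h, sub_self])
  rw [← sub_eq_zero, ← map_sub, ← hA]
  exact c.covDeriv_fundVec hρ AffGroup.contMDiff_ofLin hf hd A

theorem mdiff_act (c : AffineStructure d EP pr Ω)
    {W : Type*} [NormedAddCommGroup W] [NormedSpace ℂ W] {ρ : AffGroup d →* (W →L[ℂ] W)ˣ}
    {f : P → W} (hf : IsEquivariant (AffGroup.ofLin d) ρ f) {p : P}
    (hd : MDifferentiableAt 𝓘(ℂ, EP) 𝓘(ℂ, W) f p) (A : GLd d) :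
    MDifferentiableAt 𝓘(ℂ, EP) 𝓘(ℂ, W) f (p <• A) := by
  have e : f = ((ρ (AffGroup.ofLin d A))⁻¹ : (W →L[ℂ] W)ˣ).1 ∘ f ∘ fun q : P => q <• A⁻¹ := by
    funext q
    have := hf (q <• A⁻¹) A
    simpa using this
  rw [e]
  refine ContinuousLinearMap.mdifferentiableAt _ |>.comp _ (MDifferentiableAt.comp _ ?_
    (c.isPrincipal.mdiff_right (p <• A) A⁻¹))
  simpa using hd

theorem covDeriv_lift_act (c : AffineStructure d EP pr Ω)
    {W : Type*} [NormedAddCommGroup W] [NormedSpace ℂ W] {ρ : AffGroup d →* (W →L[ℂ] W)ˣ}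
    (hρ : ContMDiff (AffGroup.I d) 𝓘(ℂ, W →L[ℂ] W) ω (fun g => (ρ g : W →L[ℂ] W)))
    {f : P → W} (hf : IsEquivariant (AffGroup.ofLin d) ρ f) {p : P} (A : GLd d)
    (hd : MDifferentiableAt 𝓘(ℂ, EP) 𝓘(ℂ, W) f p) (X : TangentSpace 𝓘(ℂ, EP) p) :
    c.covDeriv ρ f (p <• A)
        (c.lift (p <• A) (mfderiv 𝓘(ℂ, EP) 𝓘(ℂ, Cd d) pr p X : Cd d)) =
      ((ρ (AffGroup.ofLin d A))⁻¹ : (W →L[ℂ] W)ˣ).1 (c.covDeriv ρ f p X) := by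
  rw [← c.covDeriv_rightMap hρ hf hd]
  have e : pr ∘ (fun q : P => q <• A) = pr := by
    funext q; exact c.isPrincipal.proj_act q A
  have h3 := mfderiv_comp_apply (x := p) (c.isPrincipal.mdiff_proj (p <• A))
    (c.isPrincipal.mdiff_right p A) X
  rw [e] at h3
  refine c.covDeriv_eq_of_mfderiv_eq hρ hf (mdiff_act c hf hd A) ?_
  exact (c.mfderiv_lift (p <• A) _).trans h3

theorem nablaT_mfderiv (c : AffineStructure d EP pr Ω)
    {σ : ∀ x : M, TangentSpace 𝓘(ℂ, Cd d) x} {p : P}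
    (hd : MDifferentiableAt 𝓘(ℂ, EP) 𝓘(ℂ, Cd d) (c.fieldFun σ) p) (X : TangentSpace 𝓘(ℂ, EP) p) :
    c.nablaT σ (pr p) (mfderiv 𝓘(ℂ, EP) 𝓘(ℂ, Cd d) pr p X) =
      c.frame p (c.covDeriv (AffGroup.linHom d) (c.fieldFun σ) p X) := by
  have hx := c.isPrincipal.mem p
  obtain ⟨A, hA⟩ := c.exists_act_eq (c.pr_pt hx)
  refine (c.nablaT_apply_eq σ hx _).trans ?_
  rw [hA]
  have h1 := c.covDeriv_lift_act AffGroup.contMDiff_linHom (c.isEquivariant_fieldFun σ) A hd X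
  have h2 := c.frame_act p A (((A⁻¹ : GLd d) : Cd d →L[ℂ] Cd d)
    (c.covDeriv (AffGroup.linHom d) (c.fieldFun σ) p X))
  rw [← mul_apply_eq_comp, ← Units.val_mul, mul_inv_cancel] at h2
  refine Eq.trans ?_ h2
  exact congrArg (fun u : Cd d => (c.frame (p <• A) u : Cd d)) h1

theorem nablaV_mfderiv (c : AffineStructure d EP pr Ω)
    {σ : ∀ x : M, TangentSpace 𝓘(ℂ, Cd d) x × ℂ} {p : P}
    (hd : MDifferentiableAt 𝓘(ℂ, EP) 𝓘(ℂ, Cd d × ℂ) (c.fieldFunV σ) p)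
    (X : TangentSpace 𝓘(ℂ, EP) p) :
    c.nablaV σ (pr p) (mfderiv 𝓘(ℂ, EP) 𝓘(ℂ, Cd d) pr p X) =
      c.frameV p (c.covDeriv (AffGroup.stdHom d) (c.fieldFunV σ) p X) := by
  have hx := c.isPrincipal.mem p
  obtain ⟨A, hA⟩ := c.exists_act_eq (c.pr_pt hx)
  refine (c.nablaV_apply_eq σ hx _).trans ?_
  rw [hA]
  have h1 := c.covDeriv_lift_act AffGroup.contMDiff_stdHom (c.isEquivariant_fieldFunV σ) A hd X
  set y : Cd d × ℂ := c.covDeriv (AffGroup.stdHom d) (c.fieldFunV σ) p X with hy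
  have h2 := c.frame_act p A (((A⁻¹ : GLd d) : Cd d →L[ℂ] Cd d) y.1)
  rw [← mul_apply_eq_comp, ← Units.val_mul, mul_inv_cancel] at h2
  have h3 : ((AffGroup.stdHom d (AffGroup.ofLin d A))⁻¹ : (Cd d × ℂ →L[ℂ] Cd d × ℂ)ˣ).1 y =
      (((A⁻¹ : GLd d) : Cd d →L[ℂ] Cd d) y.1, y.2) := by
    rw [← map_inv, ← map_inv]
    simp [AffGroup.stdHom, AffGroup.ofLin]
  rw [h3] at h1
  have h4 : ((c.frame (p <• A) (((A⁻¹ : GLd d) : Cd d →L[ℂ] Cd d) y.1) : Cd d), y.2) =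
      ((c.frame p y.1 : Cd d), y.2) := Prod.ext h2 rfl
  refine Eq.trans ?_ h4
  exact congrArg (fun u : Cd d × ℂ => ((c.frame (p <• A) u.1 : Cd d), u.2)) h1

end AffineStructure
end Affine
section Logarithmic

variable {d : ℕ} {M : Type*} [TopologicalSpace M] [ChartedSpace (Cd d) M]

/-- `D` is (the support of) a normal crossing divisor: near each of its points it is given by
`z_1 ⋯ z_k = 0`, `1 ≤ k ≤ d`, in holomorphic coordinates centred at the point. -/
structure IsNormalCrossingDivisor (d : ℕ) {M : Type*} [TopologicalSpace M] [ChartedSpace (Cd d) M]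
    (D : Set M) : Prop where
  isClosed : IsClosed D
  exists_chart : ∀ x ∈ D, ∃ z ∈ IsManifold.maximalAtlas 𝓘(ℂ, Cd d) ω M,
    x ∈ z.source ∧ z x = 0 ∧ ∃ k : ℕ, 1 ≤ k ∧ k ≤ d ∧
      D ∩ z.source = {y ∈ z.source | ∏ i : Fin d with i.val < k, z y i = 0}

variable (d) in
/-- The section `s` of the holomorphic vector bundle `V` with fibre `F` is holomorphic on `U`. -/
def IsHolSection (F : Type*) [NormedAddCommGroup F] [NormedSpace ℂ F] {V : M → Type*}
    [TopologicalSpace (TotalSpace F V)] [∀ x, TopologicalSpace (V x)] [FiberBundle F V]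
    (U : Set M) (s : ∀ x, V x) : Prop :=
  ContMDiffOn 𝓘(ℂ, Cd d) (𝓘(ℂ, Cd d).prod 𝓘(ℂ, F)) ω (fun x => TotalSpace.mk' F x (s x)) U

variable (d) in
/-- `v` is a section over `U` of `TM(-log D)`: a holomorphic vector field that maps local holomorphic
functions vanishing on `D` to functions vanishing on `D`. -/
structure IsLogVectorField [IsManifold 𝓘(ℂ, Cd d) ω M] (D U : Set M)
    (v : ∀ x : M, TangentSpace 𝓘(ℂ, Cd d) x) : Prop where
  isHolSection : IsHolSection d (Cd d) U v
  apply_eq_zero : ∀ (U' : Set M) (f : M → ℂ), IsOpen U' → U' ⊆ U →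
    ContMDiffOn 𝓘(ℂ, Cd d) 𝓘(ℂ, ℂ) ω f U' → (∀ x ∈ U' ∩ D, f x = 0) →
      ∀ x ∈ U' ∩ D, mvfderiv 𝓘(ℂ, Cd d) f x (v x) = 0

variable (d) in
/-- A connection `cov` on the restriction of the holomorphic vector bundle `V` on `M` to the complement
of `D` is a logarithmic connection on `V`: it extends to `TM(-log D)`, that is, `∇_v s` extends to a
holomorphic section over `U` for every section `v` of `TM(-log D)` and every holomorphic section
`s` of `V` over an open set `U`. Only the values of `cov` outside `D` matter. -/
def IsLogarithmic [IsManifold 𝓘(ℂ, Cd d) ω M] (F : Type*) [NormedAddCommGroup F] [NormedSpace ℂ F]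
    {V : M → Type*} [TopologicalSpace (TotalSpace F V)] [∀ x, TopologicalSpace (V x)]
    [FiberBundle F V] [∀ x, AddCommGroup (V x)] [∀ x, Module ℂ (V x)] (D : Set M)
    (cov : (∀ x, V x) → ∀ x : M, TangentSpace 𝓘(ℂ, Cd d) x →L[ℂ] V x) : Prop :=
  ∀ (U : Set M) (v : ∀ x : M, TangentSpace 𝓘(ℂ, Cd d) x) (s : ∀ x, V x), IsOpen U →
    IsLogVectorField d D U v → IsHolSection d F U s →
      ∃ s' : ∀ x, V x, IsHolSection d F U s' ∧ ∀ x ∈ U \ D, cov s x (v x) = s' x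

section Iso
variable (F₁ : Type*) [NormedAddCommGroup F₁] [NormedSpace ℂ F₁] (V₁ : M → Type*)
  [TopologicalSpace (TotalSpace F₁ V₁)] [∀ x, TopologicalSpace (V₁ x)]
  [FiberBundle F₁ V₁] [∀ x, AddCommGroup (V₁ x)] [∀ x, Module ℂ (V₁ x)]
  (F₂ : Type*) [NormedAddCommGroup F₂] [NormedSpace ℂ F₂] (V₂ : M → Type*)
  [TopologicalSpace (TotalSpace F₂ V₂)] [∀ x, TopologicalSpace (V₂ x)]
  [FiberBundle F₂ V₂] [∀ x, AddCommGroup (V₂ x)] [∀ x, Module ℂ (V₂ x)]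

variable (d) in
/-- An isomorphism of holomorphic vector bundles `V₁ ≅ V₂` over `Ω ⊂ M`. Only the values of `map` and
`inv` over `Ω` matter. With `V₂` the tangent bundle this says that `V₁` is an extension to `M` of
the holomorphic vector bundle `TΩ`. -/
structure HolBundleIsoOn (Ω : Set M) where
  map : ∀ x, V₁ x →L[ℂ] V₂ x
  inv : ∀ x, V₂ x →L[ℂ] V₁ x
  inv_map : ∀ x ∈ Ω, ∀ v, inv x (map x v) = v
  map_inv : ∀ x ∈ Ω, ∀ v, map x (inv x v) = v
  contMDiffOn_map : ContMDiffOn (𝓘(ℂ, Cd d).prod 𝓘(ℂ, F₁)) (𝓘(ℂ, Cd d).prod 𝓘(ℂ, F₂)) ω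
    (fun v : TotalSpace F₁ V₁ => TotalSpace.mk' F₂ v.proj (map v.proj v.snd)) (TotalSpace.proj ⁻¹' Ω)
  contMDiffOn_inv : ContMDiffOn (𝓘(ℂ, Cd d).prod 𝓘(ℂ, F₂)) (𝓘(ℂ, Cd d).prod 𝓘(ℂ, F₁)) ω
    (fun v : TotalSpace F₂ V₂ => TotalSpace.mk' F₁ v.proj (inv v.proj v.snd)) (TotalSpace.proj ⁻¹' Ω)

variable {F₁ V₁ F₂ V₂}

/-- The connection `cov` on `V₂` over `Ω`, seen on `V₁` through the isomorphism. -/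
def HolBundleIsoOn.pullback {Ω : Set M} (ι : HolBundleIsoOn d F₁ V₁ F₂ V₂ Ω)
    (cov : (∀ x, V₂ x) → ∀ x : M, TangentSpace 𝓘(ℂ, Cd d) x →L[ℂ] V₂ x)
    (s : ∀ x, V₁ x) (x : M) : TangentSpace 𝓘(ℂ, Cd d) x →L[ℂ] V₁ x :=
  (ι.inv x).comp (cov (fun y => ι.map y (s y)) x)

theorem contMDiffOn_addTrivial {Ω : Set M} (f : ∀ x, V₁ x →L[ℂ] V₂ x)
    (hf : ContMDiffOn (𝓘(ℂ, Cd d).prod 𝓘(ℂ, F₁)) (𝓘(ℂ, Cd d).prod 𝓘(ℂ, F₂)) ω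
      (fun v : TotalSpace F₁ V₁ => TotalSpace.mk' F₂ v.proj (f v.proj v.snd))
      (TotalSpace.proj ⁻¹' Ω)) :
    ContMDiffOn (𝓘(ℂ, Cd d).prod 𝓘(ℂ, F₁ × ℂ)) (𝓘(ℂ, Cd d).prod 𝓘(ℂ, F₂ × ℂ)) ω
      (fun v : TotalSpace (F₁ × ℂ) (V₁ ×ᵇ Bundle.Trivial M ℂ) =>
        TotalSpace.mk' (E := V₂ ×ᵇ Bundle.Trivial M ℂ) (F₂ × ℂ) v.proj
          ((f v.proj).prodMap (ContinuousLinearMap.id ℂ ℂ) v.snd)) (TotalSpace.proj ⁻¹' Ω) := by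
  have h1 : ContMDiff (𝓘(ℂ, Cd d).prod 𝓘(ℂ, F₁ × ℂ)) (𝓘(ℂ, Cd d).prod 𝓘(ℂ, F₁)) ω
      (fun v : TotalSpace (F₁ × ℂ) (V₁ ×ᵇ Bundle.Trivial M ℂ) =>
        TotalSpace.mk' F₁ v.proj v.snd.1) := by
    intro v
    rw [contMDiffAt_totalSpace]
    have h := contMDiffAt_totalSpace.1 (contMDiffAt_id (x := v) (n := ω)
      (I := 𝓘(ℂ, Cd d).prod 𝓘(ℂ, F₁ × ℂ)))
    exact ⟨h.1, (ContinuousLinearMap.fst ℂ F₁ ℂ).contMDiff.contMDiffAt.comp v h.2⟩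
  have h2 : ContMDiff (𝓘(ℂ, Cd d).prod 𝓘(ℂ, F₁ × ℂ)) 𝓘(ℂ, ℂ) ω
      (fun v : TotalSpace (F₁ × ℂ) (V₁ ×ᵇ Bundle.Trivial M ℂ) => (v.snd.2 : ℂ)) := by
    intro v
    have h := contMDiffAt_totalSpace.1 (contMDiffAt_id (x := v) (n := ω)
      (I := 𝓘(ℂ, Cd d).prod 𝓘(ℂ, F₁ × ℂ)))
    exact (ContinuousLinearMap.snd ℂ F₁ ℂ).contMDiff.contMDiffAt.comp v h.2
  intro v hv
  rw [contMDiffWithinAt_totalSpace]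
  have h3 := hf.comp h1.contMDiffOn (fun v hv => hv) v hv
  rw [contMDiffWithinAt_totalSpace] at h3
  exact ⟨h3.1, h3.2.prodMk_space (h2 v).contMDiffWithinAt⟩

/-- The isomorphism `V₁ ⊕ 𝓞 ≅ V₂ ⊕ 𝓞` over `Ω`. -/
def HolBundleIsoOn.addTrivial {Ω : Set M} (ι : HolBundleIsoOn d F₁ V₁ F₂ V₂ Ω) :
    HolBundleIsoOn d (F₁ × ℂ) (V₁ ×ᵇ Bundle.Trivial M ℂ) (F₂ × ℂ) (V₂ ×ᵇ Bundle.Trivial M ℂ) Ω where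
  map x := (ι.map x).prodMap (ContinuousLinearMap.id ℂ ℂ)
  inv x := (ι.inv x).prodMap (ContinuousLinearMap.id ℂ ℂ)
  inv_map x hx v := Prod.ext (ι.inv_map x hx v.1) rfl
  map_inv x hx v := Prod.ext (ι.map_inv x hx v.1) rfl
  contMDiffOn_map := contMDiffOn_addTrivial _ ι.contMDiffOn_map
  contMDiffOn_inv := contMDiffOn_addTrivial _ ι.contMDiffOn_inv

end Iso
end Logarithmic
end LogAffine

end

open LogAffine

/-!
On sections of the form `(σ, 0)` of `TM' ⊕ 𝓞` the connection `∇^V` is `(∇^T σ, 0)`: the subspace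
`ℂ^d ⊕ 0` of `V` is invariant under `χ`, and `χ` acts on it through `φ`, so that the summand `TM'`
of `E^V_H` is preserved by `∇^V`, which restricts to `∇^T` there (`nablaV_inl`; the
infinitesimal statement is `infRep_stdHom_inl`). The extension `T ⊕ 𝓞` is a direct sum of bundles on
the whole of `M`. Hence, for a holomorphic section `s` of `T` and a logarithmic vector field `v`, the
derivative of `(s, 0)` along `v` extends holomorphically across `D`, and the first component of that
extension is an extension of the derivative of `s`.
-/

namespace LogAffine

/-! ### The invariant subspace `ℂ^d ⊕ 0` -/

theorem AffGroup.stdHom_comp_inl {d : ℕ} (g : AffGroup d) :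
    (AffGroup.stdHom d g : Cd d × ℂ →L[ℂ] Cd d × ℂ).comp (ContinuousLinearMap.inl ℂ (Cd d) ℂ) =
      (ContinuousLinearMap.inl ℂ (Cd d) ℂ).comp (AffGroup.linHom d g : Cd d →L[ℂ] Cd d) := by
  ext1 u
  change AffGroup.stdMap g (u, 0) = _
  rw [AffGroup.stdMap_apply]
  simp
  rfl

/-- `dχ` preserves `ℂ^d ⊕ 0` and acts on it through `dφ`. -/
theorem AffGroup.infRep_stdHom_inl {d : ℕ} (a : GroupLieAlgebra (AffGroup.I d) (AffGroup d))
    (u : Cd d) :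
    infRep (AffGroup.I d) (AffGroup.stdHom d) a (u, 0) =
      (infRep (AffGroup.I d) (AffGroup.linHom d) a u, 0) := by
  set L : (Cd d × ℂ →L[ℂ] Cd d × ℂ) →L[ℂ] (Cd d →L[ℂ] Cd d × ℂ) :=
    (ContinuousLinearMap.compL ℂ (Cd d) (Cd d × ℂ) (Cd d × ℂ)).flip
      (ContinuousLinearMap.inl ℂ (Cd d) ℂ) with hL
  set R : (Cd d →L[ℂ] Cd d) →L[ℂ] (Cd d →L[ℂ] Cd d × ℂ) :=
    ContinuousLinearMap.compL ℂ (Cd d) (Cd d) (Cd d × ℂ)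
      (ContinuousLinearMap.inl ℂ (Cd d) ℂ) with hR
  have h1 := mfderiv_comp_apply_of_eq (x := (1 : AffGroup d)) (g := L)
    (I' := 𝓘(ℂ, Cd d × ℂ →L[ℂ] Cd d × ℂ)) (I'' := 𝓘(ℂ, Cd d →L[ℂ] Cd d × ℂ))
    L.mdifferentiableAt (AffGroup.contMDiff_stdHom.mdifferentiable (by simp) _) rfl a
  have h2 := mfderiv_comp_apply_of_eq (x := (1 : AffGroup d)) (g := R)
    (I' := 𝓘(ℂ, Cd d →L[ℂ] Cd d)) (I'' := 𝓘(ℂ, Cd d →L[ℂ] Cd d × ℂ))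
    R.mdifferentiableAt (AffGroup.contMDiff_linHom.mdifferentiable (by simp) _) rfl a
  have e : L ∘ (fun g => (AffGroup.stdHom d g : Cd d × ℂ →L[ℂ] Cd d × ℂ)) =
      R ∘ (fun g => (AffGroup.linHom d g : Cd d →L[ℂ] Cd d)) :=
    funext AffGroup.stdHom_comp_inl
  rw [e] at h1
  rw [ContinuousLinearMap.mfderiv_eq] at h1 h2
  exact congrArg (fun B : Cd d →L[ℂ] Cd d × ℂ => B u) (h1.symm.trans h2)

/-- No differentiability is needed: `(f, 0)` is differentiable exactly where `f` is, and elsewhere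
both derivatives are zero by convention. -/
theorem mvfderiv_prodMk_zero {EP : Type*} [NormedAddCommGroup EP] [NormedSpace ℂ EP]
    {P : Type*} [TopologicalSpace P] [ChartedSpace EP P] {W : Type*} [NormedAddCommGroup W]
    [NormedSpace ℂ W] (f : P → W) (p : P) (X : TangentSpace 𝓘(ℂ, EP) p) :
    mvfderiv 𝓘(ℂ, EP) (fun q => (f q, (0 : ℂ))) p X = (mvfderiv 𝓘(ℂ, EP) f p X, 0) := by
  by_cases hd : MDifferentiableAt 𝓘(ℂ, EP) 𝓘(ℂ, W) f p
  · have h := mfderiv_comp_apply_of_eq (x := p) (g := ContinuousLinearMap.inl ℂ W ℂ)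
      (I' := 𝓘(ℂ, W)) (I'' := 𝓘(ℂ, W × ℂ))
      (ContinuousLinearMap.inl ℂ W ℂ).mdifferentiableAt hd rfl X
    rw [ContinuousLinearMap.mfderiv_eq] at h
    exact h
  · have hd' : ¬ MDifferentiableAt 𝓘(ℂ, EP) 𝓘(ℂ, W × ℂ) (fun q => (f q, (0 : ℂ))) p := fun h =>
      hd ((ContinuousLinearMap.fst ℂ W ℂ).mdifferentiableAt.comp p h)
    have h1 : mvfderiv 𝓘(ℂ, EP) f p X = 0 :=
      DFunLike.congr_fun (mfderiv_zero_of_not_mdifferentiableAt hd) X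
    have h2 : mvfderiv 𝓘(ℂ, EP) (fun q => (f q, (0 : ℂ))) p X = 0 :=
      DFunLike.congr_fun (mfderiv_zero_of_not_mdifferentiableAt hd') X
    rw [h1, h2]
    rfl

namespace AffineStructure

variable {d : ℕ} {M : Type*} [TopologicalSpace M] [ChartedSpace (Cd d) M]
  {EP : Type*} [NormedAddCommGroup EP] [NormedSpace ℂ EP]
  {P : Type*} [TopologicalSpace P] [ChartedSpace EP P] [IsManifold 𝓘(ℂ, EP) ω P]
  [MulAction (GLd d)ᵐᵒᵖ P] {pr : P → M} {Ω : Set M}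

theorem covDeriv_inl (c : AffineStructure d EP pr Ω) (f : P → Cd d) (p : P)
    (X : TangentSpace 𝓘(ℂ, EP) p) :
    c.covDeriv (AffGroup.stdHom d) (fun q => (f q, (0 : ℂ))) p X =
      (c.covDeriv (AffGroup.linHom d) f p X, 0) := by
  have h1 : c.covDeriv (AffGroup.stdHom d) (fun q => (f q, (0 : ℂ))) p X =
      mvfderiv 𝓘(ℂ, EP) (fun q => (f q, (0 : ℂ))) p X +
        infRep (AffGroup.I d) (AffGroup.stdHom d) (c.θ p X) (f p, 0) := rfl
  have h2 : c.covDeriv (AffGroup.linHom d) f p X =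
      mvfderiv 𝓘(ℂ, EP) f p X + infRep (AffGroup.I d) (AffGroup.linHom d) (c.θ p X) (f p) := rfl
  rw [h1, h2, mvfderiv_prodMk_zero, AffGroup.infRep_stdHom_inl]
  simp

/-- The summand `TΩ` of `TΩ ⊕ 𝓞` is preserved by `∇^V`, which restricts to `∇^T` on it. -/
theorem nablaV_inl (c : AffineStructure d EP pr Ω) (σ : ∀ x : M, TangentSpace 𝓘(ℂ, Cd d) x)
    (x : M) (w : TangentSpace 𝓘(ℂ, Cd d) x) :
    c.nablaV (fun y => (σ y, (0 : ℂ))) x w = (c.nablaT σ x w, (0 : ℂ)) := by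
  by_cases hx : x ∈ Ω
  · have e : c.nablaVAt (fun y => (σ y, (0 : ℂ))) (c.pt hx) w =
        (c.nablaAt σ (c.pt hx) w, (0 : ℂ)) :=
      congrArg (c.frameV (c.pt hx)) (c.covDeriv_inl (c.fieldFun σ) (c.pt hx) (c.lift (c.pt hx) w))
    exact (c.nablaV_apply_eq _ hx w).trans
      (e.trans (congrArg (fun u : Cd d => (u, (0 : ℂ))) (c.nablaT_apply_eq σ hx w).symm))
  · simp only [nablaV, nablaT, dif_neg hx]
    rfl

end AffineStructure

/-! ### Holomorphic sections of a direct sum with the trivial line bundle -/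

section Sections

variable {d : ℕ} {M : Type*} [TopologicalSpace M] [ChartedSpace (Cd d) M]
  {F : Type*} [NormedAddCommGroup F] [NormedSpace ℂ F] {V : M → Type*}
  [TopologicalSpace (TotalSpace F V)] [∀ x, TopologicalSpace (V x)] [∀ x, AddCommGroup (V x)]
  [FiberBundle F V] {U : Set M}

theorem IsHolSection.inl {s : ∀ x, V x} (hs : IsHolSection d F U s) :
    IsHolSection d (F × ℂ) (V := V ×ᵇ Bundle.Trivial M ℂ) U (fun x => (s x, (0 : ℂ))) := by
  intro x hx
  have h := contMDiffWithinAt_totalSpace.1 (hs x hx)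
  rw [contMDiffWithinAt_totalSpace]
  exact ⟨h.1, h.2.prodMk_space contMDiffWithinAt_const⟩

theorem IsHolSection.fst {s : ∀ x, (V ×ᵇ Bundle.Trivial M ℂ) x}
    (hs : IsHolSection d (F × ℂ) (V := V ×ᵇ Bundle.Trivial M ℂ) U s) :
    IsHolSection d F U (fun x => (s x).1) := by
  intro x hx
  have h := contMDiffWithinAt_totalSpace.1 (hs x hx)
  rw [contMDiffWithinAt_totalSpace]
  exact ⟨h.1, (ContinuousLinearMap.fst ℂ F ℂ).contMDiff.contMDiffAt.comp_contMDiffWithinAt x h.2⟩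

end Sections

end LogAffine

theorem proposition2 {d : ℕ} {M : Type*} [TopologicalSpace M] [T2Space M]
    [SecondCountableTopology M] [ConnectedSpace M] [ChartedSpace (Cd d) M]
    [IsManifold 𝓘(ℂ, Cd d) ω M]
    {D : Set M} (hD : IsNormalCrossingDivisor d D)
    {P : Type*} [TopologicalSpace P] [ChartedSpace (Cd d × (Cd d →L[ℂ] Cd d)) P]
    [IsManifold 𝓘(ℂ, Cd d × (Cd d →L[ℂ] Cd d)) ω P] [MulAction (GLd d)ᵐᵒᵖ P] {pr : P → M}
    (c : AffineStructure d (Cd d × (Cd d →L[ℂ] Cd d)) pr Dᶜ)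
    {T : M → Type*} [TopologicalSpace (TotalSpace (Cd d) T)] [∀ x, TopologicalSpace (T x)]
    [∀ x, AddCommGroup (T x)] [∀ x, Module ℂ (T x)] [FiberBundle (Cd d) T]
    [VectorBundle ℂ (Cd d) T] [ContMDiffVectorBundle ω (Cd d) T 𝓘(ℂ, Cd d)]
    (ι : HolBundleIsoOn d (Cd d) T (Cd d) (fun x : M => TangentSpace 𝓘(ℂ, Cd d) x) Dᶜ)
    (h : IsLogarithmic d (Cd d × ℂ) (V := T ×ᵇ Bundle.Trivial M ℂ) D (ι.addTrivial.pullback c.nablaV)) :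
    IsLogarithmic d (Cd d) D (ι.pullback c.nablaT) := by
  intro U v s hU hv hs
  obtain ⟨s', hs', h'⟩ := h U v (fun x => (s x, (0 : ℂ))) hU hv hs.inl
  refine ⟨fun x => (s' x).1, hs'.fst, fun x hx => ?_⟩
  have e : ι.addTrivial.pullback c.nablaV (fun x => (s x, (0 : ℂ))) x (v x) =
      (ι.pullback c.nablaT s x (v x), (0 : ℂ)) :=
    congrArg (ι.addTrivial.inv x) (c.nablaV_inl (fun y => ι.map y (s y)) x (v x))
  exact congrArg Prod.fst (e.symm.trans (h' x hx))
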